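/- Write $\mathbb{N}=\{1,2,3,\ldots\}$ and let $[\cdot]$ denote the integer part. A measure-preserving system $(X,\mathcal{B},\mu,T)$ consists of a probability space $(X,\mathcal{B},\mu)$ and a measurable map $T:X\to X$ with $\mu(T^{-1}A)=\mu(A)$ for all $A\in\mathcal{B}$; it is invertible if $T$ is a bijection. A sequence $(a_n)_{n=1}^\infty$ in $\mathbb{N}$ is called pointwise ergodic if for every ergodic invertible measure-preserving system $(X,\mathcal{B},\mu,T)$ and every $f\in L^2(\mu)$, $$\lim_{N\to\infty}\frac1N\sum_{n=1}^N f(T^{a_n}x)=\int f\,d\mu\quad\text{for almost every }x\in X.$$ **Theorem.** Let $g:\mathbb{N}\to[1,\infty)$ be a function such that the sequence $([g(n)])_{n=1}^\infty$ is pointwise ergodic, let $(X,\mathcal{B},\mu,T)$ be an invertible measure-preserving system, and let $B\in\mathcal{B}$ with $\mu(B)>0$. Then there is a set $P\subseteq\mathbb{N}$ whose natural density $$d(P)=\lim_{N\to\infty}\frac{|P\cap\{1,\ldots,N\}|}{N}$$ exists and satisfies $d(P)\ge\mu(B)$, such that for any $n_1,\ldots,n_r\in P$, $$\mu\big(B\cap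 T^{-[g(n_1)]}B\cap\cdots\cap T^{-[g(n_r)]}B\big)>0.$$ -/

import Mathlib

open MeasureTheory Filter Topology

/-- The sequence `a 1, a 2, a 3, …` is pointwise ergodic: for every ergodic invertible
measure-preserving system `(X, μ, T)` on a probability space and every `f ∈ L²(μ)`, the averages
`(1/N) ∑_{n=1}^N f (T^{a n} x)` converge to `∫ f dμ` for almost every `x`.
Mathlib's `Ergodic T μ` includes that `T` is measurable and preserves `μ`. The value `a 0` is
irrelevant. Systems on types of universe level `0` suffice: for `f` on any system, the claim for
`f` only concerns the joint law of the process `(f ∘ T^n)_n`, a shift on a space of real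
sequences. -/
def IsPointwiseErgodic (a : ℕ → ℕ) : Prop :=
  ∀ (X : Type) [MeasurableSpace X] (μ : Measure X) [IsProbabilityMeasure μ] (T : X → X),
    Ergodic T μ → Function.Bijective T →
      ∀ f : X → ℝ, MemLp f 2 μ →
        ∀ᵐ x ∂μ, Tendsto (fun N : ℕ => (1 / (N : ℝ)) * ∑ n ∈ Finset.Icc 1 N, f (T^[a n] x))
          atTop (𝓝 (∫ y, f y ∂μ))

/-- The natural density of `S ⊆ {1, 2, 3, …}` exists and equals `d`. -/
def HasNaturalDensity (S : Set ℕ) (d : ℝ) : Prop :=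
  Tendsto (fun N : ℕ => ((S ∩ Set.Icc 1 N).ncard : ℝ) / (N : ℝ)) atTop (𝓝 d)

/-! If `μ` were ergodic, the visit times of a generic point of `B` would serve as `P`. To avoid an
ergodic decomposition, pass to the shift on `ℤ → Bool`: the law of the visits to `B` gives a
stationary `ρ` (`exists_measurePreserving_boolShift`). Among invariant measures killing every
cylinder whose intersection of preimages of `B` is `μ`-null, maximise the mass of `{y 0 = true}`.
The maximisers form a compact face, so some maximiser is ergodic (`exists_ergodic_le_apply`), with
mass at least `μ B`. A generic `y` with `y 0 = true` lies in no null cylinder; its visits along `⌊g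
n⌋₊` form `P`. -/

open scoped ENNReal BoundedContinuousFunction

section CompactSpace

variable {E : Type*} [TopologicalSpace E] [MeasurableSpace E] [BorelSpace E]
  [HasOuterApproxClosed E]

/-- A nonempty compact set of probability measures has an extreme point. -/
theorem exists_mem_extremePoints_of_isCompact {K : Set (ProbabilityMeasure E)} (hK : IsCompact K)
    (hne : K.Nonempty) :
    ∃ ν ∈ K, (ν : Measure E) ∈ Set.extremePoints ℝ≥0∞ (ProbabilityMeasure.toMeasure '' K) := by
  -- Krein–Milman needs a real locally convex space; integration embeds the measures affinely and
  -- injectively into a product of lines.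
  let Φ : ProbabilityMeasure E → ((E →ᵇ ℝ) → ℝ) := fun ν f => ∫ x, f x ∂(ν : Measure E)
  have hΦ : Continuous Φ :=
    continuous_pi fun f => ProbabilityMeasure.continuous_integral_boundedContinuousFunction f
  obtain ⟨_, ⟨ν, hν, rfl⟩, hext⟩ := (hK.image hΦ).extremePoints_nonempty (hne.image Φ)
  refine ⟨ν, hν, ⟨ν, hν, rfl⟩, ?_⟩
  rintro _ ⟨ν₁, h₁, rfl⟩ _ ⟨ν₂, h₂, rfl⟩ ⟨a, b, ha, hb, hab, h⟩
  have ha' : a ≠ ∞ := fun h => by simp [h] at hab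
  have hb' : b ≠ ∞ := fun h => by simp [h] at hab
  have key : Φ ν₁ = Φ ν := by
    refine hext ⟨ν₁, h₁, rfl⟩ ⟨ν₂, h₂, rfl⟩
      ⟨a.toReal, b.toReal, ENNReal.toReal_pos ha.ne' ha', ENNReal.toReal_pos hb.ne' hb', ?_, ?_⟩
    · rw [← ENNReal.toReal_add ha' hb', hab, ENNReal.toReal_one]
    · funext f
      change a.toReal * ∫ x, f x ∂(ν₁ : Measure E) + b.toReal * ∫ x, f x ∂(ν₂ : Measure E)
        = ∫ x, f x ∂(ν : Measure E)
      rw [← h, integral_add_measure ((f.integrable _).smul_measure ha')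
        ((f.integrable _).smul_measure hb'), integral_smul_measure, integral_smul_measure]
      rfl
  exact ext_of_forall_integral_eq_of_IsFiniteMeasure fun f => congrFun key f

/-- A nonempty compact face of the set of invariant probability measures contains an ergodic
measure. -/
theorem exists_ergodic_of_isExtreme {S : E → E} {K : Set (ProbabilityMeasure E)}
    (hK : IsCompact K) (hne : K.Nonempty)
    (hface : IsExtreme ℝ≥0∞ {ν : Measure E | MeasurePreserving S ν ν ∧ IsProbabilityMeasure ν}
      (ProbabilityMeasure.toMeasure '' K)) :
    ∃ ν ∈ K, Ergodic S (ν : Measure E) := by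
  obtain ⟨ν, hν, hext⟩ := exists_mem_extremePoints_of_isCompact hK hne
  exact ⟨ν, hν, .of_mem_extremePoints (hface.extremePoints_subset_extremePoints hext)⟩

theorem continuous_probabilityMeasure_apply {C : Set E} (hC : IsClopen C) :
    Continuous fun ν : ProbabilityMeasure E => (ν : Measure E) C := by
  refine continuous_iff_continuousAt.2 fun ν => ?_
  exact ProbabilityMeasure.tendsto_measure_of_null_frontier_of_tendsto' tendsto_id
    (by simp [hC.frontier_eq])

theorem isClosed_setOf_measurePreserving {S : E → E} (hS : Continuous S) :
    IsClosed {ν : ProbabilityMeasure E | MeasurePreserving S (ν : Measure E) (ν : Measure E)} := by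
  have : {ν : ProbabilityMeasure E | MeasurePreserving S (ν : Measure E) (ν : Measure E)}
      = {ν | ν.map hS.measurable.aemeasurable = ν} := by
    ext ν
    refine ⟨fun h => Subtype.ext h.map_eq, fun h => ⟨hS.measurable, congrArg Subtype.val h⟩⟩
  rw [this]
  exact isClosed_eq (ProbabilityMeasure.continuous_map hS) continuous_id

variable [CompactSpace E] [T2Space E]

/-- An invariant probability measure that vanishes on a family of clopen sets can be replaced with
an ergodic one, without decreasing the measure of a given clopen set. -/
theorem exists_ergodic_le_apply {S : E → E} (hS : Continuous S) {ι : Type*} {N : ι → Set E}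
    (hN : ∀ i, IsClopen (N i)) {C : Set E} (hC : IsClopen C) {ρ : Measure E}
    [IsProbabilityMeasure ρ] (hρ : MeasurePreserving S ρ ρ) (hρN : ∀ i, ρ (N i) = 0) :
    ∃ ν : Measure E, IsProbabilityMeasure ν ∧ Ergodic S ν ∧ (∀ i, ν (N i) = 0) ∧ ρ C ≤ ν C := by
  let K₀ : Set (ProbabilityMeasure E) :=
    {ν | MeasurePreserving S (ν : Measure E) (ν : Measure E)} ∩ {ν | ∀ i, (ν : Measure E) (N i) = 0}
  have hK₀c : IsCompact K₀ := by
    refine ((isClosed_setOf_measurePreserving hS).inter ?_).isCompact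
    simp only [Set.ofPred_forall]
    exact isClosed_iInter fun i =>
      isClosed_eq (continuous_probabilityMeasure_apply (hN i)) continuous_const
  have hρK : (⟨ρ, inferInstance⟩ : ProbabilityMeasure E) ∈ K₀ := ⟨hρ, hρN⟩
  have hcont := continuous_probabilityMeasure_apply hC
  obtain ⟨m, hm, hmax⟩ := hK₀c.exists_isMaxOn ⟨_, hρK⟩ hcont.continuousOn
  -- The maximisers of an affine functional on a face form a face.
  let K : Set (ProbabilityMeasure E) := K₀ ∩ {ν | (m : Measure E) C ≤ (ν : Measure E) C}
  obtain ⟨ν, ⟨hν₀, hνm⟩, hν⟩ := exists_ergodic_of_isExtreme (S := S) (K := K)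
    (hK₀c.inter_right (isClosed_le continuous_const hcont)) ⟨m, hm, le_refl ((m : Measure E) C)⟩ (by
      refine ⟨?_, ?_⟩
      · rintro _ ⟨ν, hν, rfl⟩
        exact ⟨hν.1.1, inferInstance⟩
      · rintro ν₁ ⟨h₁, hp₁⟩ ν₂ ⟨h₂, hp₂⟩ _ ⟨ν, hν, rfl⟩ ⟨a, b, ha, hb, hab, h⟩
        have happ (A : Set E) : a * ν₁ A + b * ν₂ A = (ν : Measure E) A := by
          rw [← h]; rfl
        have hz (i : ι) : ν₁ (N i) = 0 ∧ ν₂ (N i) = 0 := by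
          simpa [hν.1.2 i, ha.ne', hb.ne'] using happ (N i)
        have hK₁ : (⟨ν₁, hp₁⟩ : ProbabilityMeasure E) ∈ K₀ := ⟨h₁, fun i => (hz i).1⟩
        have hK₂ : (⟨ν₂, hp₂⟩ : ProbabilityMeasure E) ∈ K₀ := ⟨h₂, fun i => (hz i).2⟩
        refine ⟨⟨ν₁, hp₁⟩, ⟨hK₁, ?_⟩, rfl⟩
        change (m : Measure E) C ≤ ν₁ C
        by_contra! hlt
        have hle : ν₂ C ≤ (m : Measure E) C := hmax hK₂
        have ha' : a ≠ ∞ := fun h => by simp [h] at hab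
        have hb' : b ≠ ∞ := fun h => by simp [h] at hab
        have hcontra : a * ν₁ C + b * ν₂ C < a * (m : Measure E) C + b * (m : Measure E) C :=
          ENNReal.add_lt_add_of_lt_of_le (ENNReal.mul_ne_top hb' (measure_ne_top _ _))
            (ENNReal.mul_lt_mul_right ha.ne' ha' hlt) (by gcongr)
        rw [happ, ← add_mul, hab, one_mul] at hcontra
        exact hcontra.not_ge hν.2)
  exact ⟨ν, inferInstance, hν, hν₀.2, (hmax hρK).trans hνm⟩

/-- If `S` maps `ν k` to `ν (k + 1)` for all `k`, some limit point of the averages of the `ν k` is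
invariant; its value on a clopen set is the common value of the `ν k` there, if there is one. -/
theorem exists_measurePreserving_of_map_eq_succ {S : E → E} (hS : Continuous S) (ν : ℕ → Measure E)
    [∀ k, IsProbabilityMeasure (ν k)] (hν : ∀ k, (ν k).map S = ν (k + 1)) :
    ∃ ρ : Measure E, IsProbabilityMeasure ρ ∧ MeasurePreserving S ρ ρ ∧
      ∀ C : Set E, IsClopen C → ∀ c, (∀ k, ν k C = c) → ρ C = c := by
  -- Krylov–Bogolyubov averages: the defect of invariance telescopes to two terms divided by `n +
  -- 1`.
  let A : ℕ → Measure E := fun n => ((n : ℝ≥0∞) + 1)⁻¹ • ∑ k ∈ Finset.range (n + 1), ν k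
  have hA (n : ℕ) (C : Set E) (c : ℝ≥0∞) (h : ∀ k, ν k C = c) : A n C = c := by
    have h0 : (n : ℝ≥0∞) + 1 ≠ 0 := by simp
    have h1 : (n : ℝ≥0∞) + 1 ≠ ∞ := by finiteness
    simp [A, h, ← mul_assoc, ENNReal.inv_mul_cancel h0 h1]
  have hprob (n : ℕ) : IsProbabilityMeasure (A n) := ⟨hA n _ _ fun k => measure_univ⟩
  let P : ℕ → ProbabilityMeasure E := fun n => ⟨A n, hprob n⟩
  let U : Ultrafilter ℕ := hyperfilter ℕ
  have hU : Tendsto P U (𝓝 (U.map P).lim) := (U.map P).le_nhds_lim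
  set ρ := (U.map P).lim
  have hUtop : (U : Filter ℕ) ≤ atTop := by
    rw [← Nat.cofinite_eq_atTop]; exact hyperfilter_le_cofinite
  refine ⟨ρ, inferInstance, ⟨hS.measurable, ?_⟩, fun C hC c hc => ?_⟩
  · have hmap : IsProbabilityMeasure ((ρ : Measure E).map S) :=
      Measure.isProbabilityMeasure_map hS.aemeasurable
    refine ext_of_forall_integral_eq_of_IsFiniteMeasure fun f => ?_
    rw [integral_map hS.aemeasurable f.continuous.aestronglyMeasurable]
    have hlim := ProbabilityMeasure.tendsto_iff_forall_integral_tendsto.1 hU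
    let fS : E →ᵇ ℝ := f.compContinuous ⟨S, hS⟩
    have hdiff (n : ℕ) : ∫ x, fS x ∂(P n : Measure E) - ∫ x, f x ∂(P n : Measure E)
        = ((n : ℝ) + 1)⁻¹ * (∫ x, f x ∂ν (n + 1) - ∫ x, f x ∂ν 0) := by
      have hint (h : E →ᵇ ℝ) : ∫ x, h x ∂(P n : Measure E)
          = ((n : ℝ) + 1)⁻¹ * ∑ k ∈ Finset.range (n + 1), ∫ x, h x ∂ν k := by
        change ∫ x, h x ∂A n = _
        rw [integral_smul_measure, integral_finsetSum_measure fun k _ => h.integrable _]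
        have : (((n : ℝ≥0∞) + 1)⁻¹).toReal = ((n : ℝ) + 1)⁻¹ := by
          rw [ENNReal.toReal_inv, ENNReal.toReal_add (by simp) (by simp)]; simp
        rw [this, smul_eq_mul]
      rw [hint, hint, ← mul_sub, ← Finset.sum_sub_distrib,
        ← Finset.sum_range_sub fun k => ∫ x, f x ∂ν k]
      congr 1
      refine Finset.sum_congr rfl fun k _ => ?_
      rw [← hν k, integral_map hS.aemeasurable f.continuous.aestronglyMeasurable]
      rfl
    have hzero : Tendsto (fun n : ℕ => ((n : ℝ) + 1)⁻¹ * (∫ x, f x ∂ν (n + 1) - ∫ x, f x ∂ν 0))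
        U (𝓝 0) := by
      refine Tendsto.mono_left ?_ hUtop
      have hinv : Tendsto (fun n : ℕ => ((n : ℝ) + 1)⁻¹) atTop (𝓝 0) := by
        simpa using tendsto_one_div_add_atTop_nhds_zero_nat (𝕜 := ℝ)
      have hbd (k : ℕ) : ‖∫ x, f x ∂ν k‖ ≤ ‖f‖ := by
        simpa using f.norm_integral_le_norm (ν k)
      refine hinv.zero_mul_isBoundedUnder_le ⟨‖f‖ + ‖f‖, ?_⟩
      simp only [eventually_map]
      exact Eventually.of_forall fun n => (norm_sub_le _ _).trans (add_le_add (hbd _) (hbd _))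
    have h2 := (hlim fS).sub (hlim f)
    simp only [hdiff] at h2
    exact sub_eq_zero.1 (tendsto_nhds_unique h2 hzero)
  · have h1 := (continuous_probabilityMeasure_apply hC).continuousAt.tendsto.comp hU
    have h2 : ((fun ν : ProbabilityMeasure E => (ν : Measure E) C) ∘ P) = fun _ => c :=
      funext fun n => hA n C c hc
    rw [h2] at h1
    exact tendsto_nhds_unique h1 tendsto_const_nhds

end CompactSpace

/-! ### Transfer to the two-sided shift -/

/-- The two-sided shift on `ℤ → Bool`. -/
def boolShift (y : ℤ → Bool) : ℤ → Bool := fun i => y (i + 1)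

theorem continuous_boolShift : Continuous boolShift :=
  continuous_pi fun i => continuous_apply (i + 1)

theorem bijective_boolShift : Function.Bijective boolShift := by
  refine ⟨fun x y h => funext fun i => ?_, fun y => ⟨fun i => y (i - 1), ?_⟩⟩
  · simpa [boolShift] using congrFun h (i - 1)
  · funext i; simp [boolShift]

theorem boolShift_iterate_apply (n : ℕ) (y : ℤ → Bool) (i : ℤ) :
    boolShift^[n] y i = y (i + n) := by
  induction n generalizing i with
  | zero => simp
  | succ n ih =>
    rw [Function.iterate_succ_apply']
    simp only [boolShift, ih]
    congr 1; push_cast; ring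

/-- The set of `y` that take the value `true` on `F`. -/
def boolCylinder (F : Finset ℕ) : Set (ℤ → Bool) := {y | ∀ i ∈ F, y i = true}

theorem isClopen_boolCylinder (F : Finset ℕ) : IsClopen (boolCylinder F) := by
  have : boolCylinder F = ⋂ i ∈ F, (fun y : ℤ → Bool => y i) ⁻¹' {true} := by
    ext y; simp [boolCylinder]
  rw [this]
  exact isClopen_biInter_finset fun i _ => (isClopen_discrete _).preimage (continuous_apply _)

section Itinerary

variable {X : Type*} (T : X → X) (B : Set X)

open Classical in
/-- The itinerary of `x` with respect to `B`, started at time `-k`. -/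
noncomputable def itinerary (k : ℕ) (x : X) : ℤ → Bool :=
  -- Times before `-k` get the default `false`, so `T` is never inverted; averaging over `k`
  -- restores stationarity on all of `ℤ`.
  fun i => decide (0 ≤ i + k ∧ T^[(i + k).toNat] x ∈ B)

theorem boolShift_itinerary (k : ℕ) (x : X) :
    boolShift (itinerary T B k x) = itinerary T B (k + 1) x := by
  funext i
  simp only [boolShift, itinerary]
  have : i + 1 + (k : ℤ) = i + ((k + 1 : ℕ) : ℤ) := by push_cast; ring
  rw [this]

/-- Indices in `F` are nonnegative, so the default value never enters; when `T` preserves `μ`, the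
measure of this set does not depend on `k`. -/
theorem itinerary_preimage_boolCylinder (k : ℕ) (F : Finset ℕ) :
    itinerary T B k ⁻¹' boolCylinder F = T^[k] ⁻¹' ⋂ i ∈ F, T^[i] ⁻¹' B := by
  ext x
  simp only [boolCylinder, itinerary, Set.mem_preimage, Set.mem_ofPred_eq, decide_eq_true_eq,
    Set.mem_iInter, ← Function.iterate_add_apply]
  refine forall₂_congr fun i _ => ?_
  have h : (i : ℤ) + k = ((i + k : ℕ) : ℤ) := by push_cast; rfl
  rw [h, Int.toNat_natCast]
  exact and_iff_right (Int.natCast_nonneg _)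

variable {T B} [MeasurableSpace X]

theorem measurable_itinerary (hT : Measurable T) (hB : MeasurableSet B) (k : ℕ) :
    Measurable (itinerary T B k) := by
  refine measurable_pi_iff.2 fun i => measurable_to_bool ?_
  have : (fun x => itinerary T B k x i) ⁻¹' {true}
      = {x | 0 ≤ i + (k : ℤ)} ∩ T^[(i + k).toNat] ⁻¹' B := by
    ext x; simp [itinerary]
  rw [this]
  exact (MeasurableSet.const _).inter (hT.iterate _ hB)

/-- The joint law of the visits to `B` is realised by a two-sided stationary process. -/
theorem exists_measurePreserving_boolShift {μ : Measure X} [IsProbabilityMeasure μ]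
    (hT : MeasurePreserving T μ μ) (hB : MeasurableSet B) :
    ∃ ρ : Measure (ℤ → Bool), IsProbabilityMeasure ρ ∧ MeasurePreserving boolShift ρ ρ ∧
      ∀ F : Finset ℕ, ρ (boolCylinder F) = μ (⋂ i ∈ F, T^[i] ⁻¹' B) := by
  have hmeas := measurable_itinerary hT.measurable hB
  have hprob (k : ℕ) : IsProbabilityMeasure (μ.map (itinerary T B k)) :=
    Measure.isProbabilityMeasure_map (hmeas k).aemeasurable
  obtain ⟨ρ, hρ, hinv, hval⟩ := exists_measurePreserving_of_map_eq_succ continuous_boolShift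
    (fun k => μ.map (itinerary T B k)) fun k => by
      rw [Measure.map_map continuous_boolShift.measurable (hmeas k)]
      exact congrArg (μ.map ·) (funext fun x => boolShift_itinerary T B k x)
  refine ⟨ρ, hρ, hinv, fun F => hval _ (isClopen_boolCylinder F) _ fun k => ?_⟩
  rw [Measure.map_apply (hmeas k) (isClopen_boolCylinder F).isOpen.measurableSet,
    itinerary_preimage_boolCylinder]
  exact (hT.iterate k).measure_preimage
    (F.measurableSet_biInter fun i _ => hT.measurable.iterate i hB).nullMeasurableSet

end Itinerary

/-- Along a generic point, the density of the set of return times is the measure of the set. -/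
theorem IsPointwiseErgodic.ae_hasNaturalDensity {a : ℕ → ℕ} (ha : IsPointwiseErgodic a) {Y : Type}
    [MeasurableSpace Y] {ν : Measure Y} [IsProbabilityMeasure ν] {S : Y → Y} (hS : Ergodic S ν)
    (hbij : Function.Bijective S) {C : Set Y} (hC : MeasurableSet C) :
    ∀ᵐ y ∂ν, HasNaturalDensity {n | 1 ≤ n ∧ S^[a n] y ∈ C} (ν.real C) := by
  classical
  have h := ha Y ν S hS hbij (C.indicator fun _ => (1 : ℝ))
    (memLp_indicator_const 2 hC 1 (Or.inr (measure_ne_top _ _)))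
  filter_upwards [h] with y hy
  rw [integral_indicator_const _ hC, smul_eq_mul, mul_one] at hy
  refine hy.congr fun N => ?_
  have hset : {n | 1 ≤ n ∧ S^[a n] y ∈ C} ∩ Set.Icc 1 N
      = ((Finset.Icc 1 N).filter fun n => S^[a n] y ∈ C : Finset ℕ) := by
    ext n; simp; tauto
  rw [hset, Set.ncard_coe_finset]
  simp [Set.indicator_apply, Finset.sum_boole, div_eq_inv_mul]

theorem theorem3p7
    (g : ℕ → ℝ) (hg : ∀ n : ℕ, 1 ≤ n → 1 ≤ g n)
    (hpe : IsPointwiseErgodic (fun n => ⌊g n⌋₊))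
    {X : Type*} [MeasurableSpace X] (μ : Measure X) [IsProbabilityMeasure μ]
    (T : X → X) (hT : MeasurePreserving T μ μ) (hTinv : Function.Bijective T)
    (B : Set X) (hB : MeasurableSet B) (hBpos : 0 < μ B) :
    ∃ P : Set ℕ, (∀ n ∈ P, 1 ≤ n) ∧
      (∃ d : ℝ, HasNaturalDensity P d ∧ μ.real B ≤ d) ∧
      ∀ (r : ℕ) (n : Fin r → ℕ), (∀ i, n i ∈ P) →
        0 < μ (B ∩ ⋂ i, T^[⌊g (n i)⌋₊] ⁻¹' B) := by
  obtain ⟨ρ, hρ, hρinv, hρval⟩ := exists_measurePreserving_boolShift hT hB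
  have hρB : ρ (boolCylinder {0}) = μ B := by simp [hρval]
  obtain ⟨ν, hνp, hν, hνnull, hνle⟩ := exists_ergodic_le_apply continuous_boolShift
    (N := fun F : {F : Finset ℕ // μ (⋂ i ∈ F, T^[i] ⁻¹' B) = 0} => boolCylinder F)
    (fun F => isClopen_boolCylinder F) (isClopen_boolCylinder {0}) hρinv
    fun F => (hρval F).trans F.2
  rw [hρB] at hνle
  have hgood := (hpe.ae_hasNaturalDensity hν bijective_boolShift
    -- There are only countably many finite sets `F`, so almost every `y` avoids all null cylinders
    -- at once.
    (isClopen_boolCylinder {0}).isOpen.measurableSet).and (ae_all_iff.2 fun F =>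
      measure_eq_zero_iff_ae_notMem.1 (hνnull F))
  obtain ⟨y, hy0, hdens, hy⟩ := nonempty_of_measure_ne_zero
    (((measure_inter_conull (μ := ν) (s := boolCylinder {0}) hgood).trans_ne
      (hBpos.trans_le hνle).ne'))
  refine ⟨_, fun n hn => hn.1, ⟨_, hdens, ?_⟩, fun r n hn => ?_⟩
  · exact ENNReal.toReal_mono (measure_ne_top _ _) hνle
  -- The index `0` accounts for the factor `B` itself.
  · let F : Finset ℕ := insert 0 (Finset.univ.image fun i => ⌊g (n i)⌋₊)
    have hyF : y ∈ boolCylinder F := by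
      intro i hi
      rcases Finset.mem_insert.1 hi with rfl | hi
      · exact hy0 0 (by simp)
      · obtain ⟨j, -, rfl⟩ := Finset.mem_image.1 hi
        simpa [boolCylinder, boolShift_iterate_apply] using (hn j).2
    have hF : B ∩ ⋂ i, T^[⌊g (n i)⌋₊] ⁻¹' B = ⋂ i ∈ F, T^[i] ⁻¹' B := by
      ext x; simp [F]
    rw [hF]
    exact pos_iff_ne_zero.2 fun h => hy ⟨F, h⟩ hyF
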